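/- Let $\mathcal H$ be a complex separable infinite-dimensional Hilbert space and let $A\neq 0$ be a positive bounded linear operator on $\mathcal H$. Write $\langle x,y\rangle_A=\langle Ax,y\rangle$ and $\|x\|_A=\sqrt{\langle x,x\rangle_A}$. A bounded operator $T$ on $\mathcal H$ is $A$-bounded if there is $c>0$ with $\|Tx\|_A\le c\|x\|_A$ for all $x\in\mathcal H$; in that case $$\|T\|_A=\sup\Big\{\frac{\|Tx\|_A}{\|x\|_A}: x\in\overline{R(A)},\ x\ne 0\Big\},\qquad W_A(T)=\{\langle Tx,x\rangle_A: x\in\mathcal H,\ \|x\|_A=1\}.$$ An $A$-bounded operator $K$ is $A$-compact if for every sequence $(x_n)$ in $\mathcal H$ with $\sup_n\|x_n\|_A<\infty$ there are a subsequence $(x_{n_k})$ and $y\in\mathcal H$ with $\|Kx_{n_k}-y\|_A\to 0$. Let $\mathbf R(A^{1/2})$ be the Hilbert space $R(A^{1/2})$ with the inner product $(A^{1/2}x,A^{1/2}y)=\langle Px,Py\rangle$, where $P$ is the orthogonal projection onto $\overline{R(A)}$, and let $Z_A:\mathcal H\to\mathbf R(A^{1/2})$, $Z_Ax=Ax$.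 For an $A$-bounded $T$ let $\widetilde T$ be the unique bounded operator on $\mathbf R(A^{1/2})$ with $Z_AT=\widetilde TZ_A$. One says that $T$ induces a complex symmetric operator if $\widetilde T$ is complex symmetric, i.e. $\widetilde T=C\widetilde T^{*}C$ for some conjugate-linear isometric involution $C$ of $\mathbf R(A^{1/2})$. Suppose that $R(A)$ is closed and that $T$ is an $A$-bounded operator that induces a complex symmetric operator. Then for every $\varepsilon>0$ there is an $A$-compact operator $K$ with $\|K\|_A<\varepsilon$ such that $T+K$ induces a complex symmetric operator and $\overline{W_A(T+K)}=W_A(T+K)$. -/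

import Mathlib

open scoped InnerProductSpace

noncomputable section

namespace SemiHilbert

variable {H : Type*} [NormedAddCommGroup H] [InnerProductSpace ℂ H] [CompleteSpace H]

/-! ### The semi-inner product of a positive operator -/

/-- `⟨x, y⟩_A = ⟨A x, y⟩`, linear in `x` and conjugate-linear in `y`
(Mathlib's `inner` is conjugate-linear in its first argument). -/
def aInner (A : H →L[ℂ] H) (x y : H) : ℂ := inner ℂ y (A x)

/-- The seminorm `‖x‖_A = √⟨x, x⟩_A`. -/
def aSeminorm (A : H →L[ℂ] H) (x : H) : ℝ := Real.sqrt (aInner A x x).re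

/-- `A`-bounded operators. -/
def IsABounded (A T : H →L[ℂ] H) : Prop :=
  ∃ c : ℝ, 0 < c ∧ ∀ x : H, aSeminorm A (T x) ≤ c * aSeminorm A x

/-- The `A`-operator seminorm: supremum of `‖T x‖_A / ‖x‖_A` over nonzero `x` in the closure of
`R(A)`. (For `A` positive and nonzero and `T` an `A`-bounded operator, this set of reals is nonempty
and bounded above.) -/
def aOpNorm (A T : H →L[ℂ] H) : ℝ :=
  sSup {r : ℝ | ∃ x ∈ closure (Set.range A), x ≠ 0 ∧ r = aSeminorm A (T x) / aSeminorm A x}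

/-- `A`-compact operators: `A`-bounded operators that map every `A`-bounded sequence to a sequence
with an `A`-convergent subsequence. -/
def IsACompact (A K : H →L[ℂ] H) : Prop :=
  IsABounded A K ∧
    ∀ x : ℕ → H, (∃ M : ℝ, ∀ n, aSeminorm A (x n) ≤ M) →
      ∃ (φ : ℕ → ℕ) (y : H), StrictMono φ ∧
        Filter.Tendsto (fun n => aSeminorm A (K (x (φ n)) - y)) Filter.atTop (nhds 0)

/-- The `A`-numerical range. -/
def aNumericalRange (A T : H →L[ℂ] H) : Set ℂ :=
  {z : ℂ | ∃ x : H, aSeminorm A x = 1 ∧ z = aInner A (T x) x}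

/-! ### The Hilbert space `R(A^{1/2})` -/

/-- The range of `A^{1/2}`, as a vector space. It carries its own inner product (defined below),
not the one inherited from `H`. -/
def RSqrt (A : H →L[ℂ] H) : Type _ := LinearMap.range (CFC.sqrt A : H →L[ℂ] H).toLinearMap

namespace RSqrt

variable (A : H →L[ℂ] H)

instance : AddCommGroup (RSqrt A) :=
  inferInstanceAs (AddCommGroup (LinearMap.range (CFC.sqrt A : H →L[ℂ] H).toLinearMap))

instance : Module ℂ (RSqrt A) :=
  inferInstanceAs (Module ℂ (LinearMap.range (CFC.sqrt A : H →L[ℂ] H).toLinearMap))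

/-- The inclusion of `R(A^{1/2})` into `H` (linear; in general not isometric). -/
def incl : RSqrt A →ₗ[ℂ] H :=
  (LinearMap.range (CFC.sqrt A : H →L[ℂ] H).toLinearMap).subtype

/-- The vector `A^{1/2} x` of `R(A^{1/2})`. -/
def mk : H →ₗ[ℂ] RSqrt A := (CFC.sqrt A : H →L[ℂ] H).toLinearMap.rangeRestrict

instance : CompleteSpace (LinearMap.ker (CFC.sqrt A : H →L[ℂ] H).toLinearMap) :=
  (CFC.sqrt A : H →L[ℂ] H).isClosed_ker.completeSpace_coe

/-- The linear map `A^{1/2} x ↦ P x`, where `P` is the orthogonal projection onto the orthogonal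
complement of `N(A^{1/2})`, which is the closure of `R(A)` for positive `A`
(see `inner_mk_mk` below). -/
def lift : RSqrt A →ₗ[ℂ] H :=
  ((LinearMap.ker (CFC.sqrt A : H →L[ℂ] H).toLinearMap).liftQ
    ((LinearMap.ker (CFC.sqrt A : H →L[ℂ] H).toLinearMap)ᗮ.starProjection).toLinearMap
    (by simp [Submodule.ker_starProjection, Submodule.orthogonal_orthogonal])) ∘ₗ
  ((CFC.sqrt A : H →L[ℂ] H).toLinearMap.quotKerEquivRange.symm).toLinearMap

lemma mk_surjective : Function.Surjective (mk A) :=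
  (CFC.sqrt A : H →L[ℂ] H).toLinearMap.surjective_rangeRestrict

lemma lift_mk (x : H) : lift A (mk A x) =
    (LinearMap.ker (CFC.sqrt A : H →L[ℂ] H).toLinearMap)ᗮ.starProjection x := by
  have h : (CFC.sqrt A : H →L[ℂ] H).toLinearMap.quotKerEquivRange.symm (mk A x) =
      (LinearMap.ker (CFC.sqrt A : H →L[ℂ] H).toLinearMap).mkQ x := by
    exact (LinearEquiv.symm_apply_eq _).2 rfl
  exact congrArg ((LinearMap.ker (CFC.sqrt A : H →L[ℂ] H).toLinearMap).liftQ
    ((LinearMap.ker (CFC.sqrt A : H →L[ℂ] H).toLinearMap)ᗮ.starProjection).toLinearMap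
    (by simp [Submodule.ker_starProjection, Submodule.orthogonal_orthogonal])) h

lemma mk_eq_zero_iff (x : H) :
    mk A x = 0 ↔ x ∈ LinearMap.ker (CFC.sqrt A : H →L[ℂ] H).toLinearMap := by
  exact Subtype.ext_iff

lemma lift_injective : Function.Injective (lift A) := by
  rw [injective_iff_map_eq_zero]
  intro u hu
  obtain ⟨x, rfl⟩ := mk_surjective A u
  rw [lift_mk] at hu
  rw [mk_eq_zero_iff]
  have : x ∈ ((LinearMap.ker (CFC.sqrt A : H →L[ℂ] H).toLinearMap)ᗮ.starProjection).ker := hu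
  simpa [Submodule.ker_starProjection, Submodule.orthogonal_orthogonal] using this

/-- The norm of `R(A^{1/2})`: `‖A^{1/2} x‖ = ‖P x‖`. -/
instance : NormedAddCommGroup (RSqrt A) :=
  NormedAddCommGroup.induced (RSqrt A) H (lift A) (lift_injective A)

/-- The inner product of `R(A^{1/2})`: `(A^{1/2} x, A^{1/2} y) = ⟨P x, P y⟩`. -/
instance : InnerProductSpace ℂ (RSqrt A) where
  inner u v := inner ℂ (lift A u) (lift A v)
  norm_smul_le c u := by
    change ‖lift A (c • u)‖ ≤ ‖c‖ * ‖lift A u‖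
    rw [map_smul, norm_smul]
  norm_sq_eq_re_inner u := by
    change ‖lift A u‖ ^ 2 = _
    exact norm_sq_eq_re_inner (𝕜 := ℂ) (lift A u)
  conj_inner_symm u v := inner_conj_symm _ _
  add_left u v w := by
    rw [map_add, inner_add_left]
  smul_left u v c := by
    rw [map_smul, inner_smul_left]

lemma isometry_lift : Isometry (lift A) :=
  AddMonoidHomClass.isometry_of_norm _ fun _ => rfl

lemma range_lift : Set.range (lift A) =
    ((LinearMap.ker (CFC.sqrt A : H →L[ℂ] H).toLinearMap)ᗮ : Submodule ℂ H) := by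
  ext y
  constructor
  · rintro ⟨u, rfl⟩
    obtain ⟨x, rfl⟩ := mk_surjective A u
    rw [lift_mk]
    exact Submodule.starProjection_apply_mem _ _
  · intro hy
    exact ⟨mk A y, by rw [lift_mk, Submodule.starProjection_eq_self_iff.mpr hy]⟩

instance : CompleteSpace (RSqrt A) := by
  rw [completeSpace_iff_isComplete_range (isometry_lift A).isUniformInducing, range_lift]
  exact (Submodule.isClosed_orthogonal _).isComplete

variable {A}

lemma sqrt_sqrt_apply (hA : A.IsPositive) (x : H) : CFC.sqrt A (CFC.sqrt A x) = A x := by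
  have h := CFC.sqrt_mul_sqrt_self A ((ContinuousLinearMap.nonneg_iff_isPositive A).2 hA)
  exact congrArg (fun B : H →L[ℂ] H => B x) h

lemma ker_sqrt_orthogonal (hA : A.IsPositive) :
    (LinearMap.ker (CFC.sqrt A : H →L[ℂ] H).toLinearMap)ᗮ =
      (LinearMap.range A.toLinearMap).topologicalClosure := by
  have hS : IsSelfAdjoint (CFC.sqrt A : H →L[ℂ] H) := (CFC.sqrt_nonneg A).isSelfAdjoint
  have hk : LinearMap.ker (CFC.sqrt A : H →L[ℂ] H).toLinearMap = LinearMap.ker A.toLinearMap := by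
    ext x
    simp only [LinearMap.mem_ker, ContinuousLinearMap.coe_coe]
    constructor
    · intro h
      rw [← sqrt_sqrt_apply hA, h, map_zero]
    · intro h
      rw [← sqrt_sqrt_apply hA] at h
      rw [← inner_self_eq_zero (𝕜 := ℂ)]
      have h1 := ContinuousLinearMap.adjoint_inner_left (CFC.sqrt A : H →L[ℂ] H) x (CFC.sqrt A x)
      rw [hS.adjoint_eq, h, inner_zero_left] at h1
      exact h1.symm
  rw [hk, A.orthogonal_ker, hA.isSelfAdjoint.adjoint_eq]

/-- The defining formula of the inner product of `R(A^{1/2})`. -/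
lemma inner_mk_mk (hA : A.IsPositive) (x y : H) :
    inner ℂ (mk A x) (mk A y) =
      inner ℂ ((LinearMap.range A.toLinearMap).topologicalClosure.starProjection x)
        ((LinearMap.range A.toLinearMap).topologicalClosure.starProjection y) := by
  change inner ℂ (lift A (mk A x)) (lift A (mk A y)) = _
  simp only [lift_mk, ker_sqrt_orthogonal hA]

end RSqrt

/-- The map `Z_A : H → R(A^{1/2})`, `Z_A x = A x`. -/
def zMap {A : H →L[ℂ] H} (hA : A.IsPositive) : H →ₗ[ℂ] RSqrt A :=
  LinearMap.codRestrict (LinearMap.range (CFC.sqrt A : H →L[ℂ] H).toLinearMap) A.toLinearMap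
    (fun x => ⟨CFC.sqrt A x, RSqrt.sqrt_sqrt_apply hA x⟩)

lemma incl_zMap {A : H →L[ℂ] H} (hA : A.IsPositive) (x : H) :
    RSqrt.incl A (zMap hA x) = A x := rfl

/-! ### Complex symmetric operators -/

/-- A bounded operator `S` on a Hilbert space is complex symmetric if `S = C S* C` for some
conjugation `C`, i.e. some conjugate-linear isometric involution. -/
def IsComplexSymmetric {E : Type*} [NormedAddCommGroup E] [InnerProductSpace ℂ E]
    [CompleteSpace E] (S : E →L[ℂ] E) : Prop :=
  ∃ C : E →ₗᵢ⋆[ℂ] E, (∀ x, C (C x) = x) ∧ ∀ x, S x = C (ContinuousLinearMap.adjoint S (C x))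

/-- `T` is `A`-bounded and the bounded operator `S` on `R(A^{1/2})` with `Z_A T = S Z_A` is complex
symmetric. (There is exactly one such `S`, as `R(A)` is dense in `R(A^{1/2})`.) -/
def InducesCSO {A : H →L[ℂ] H} (hA : A.IsPositive) (T : H →L[ℂ] H) : Prop :=
  IsABounded A T ∧
    ∃ S : RSqrt A →L[ℂ] RSqrt A, (∀ x : H, zMap hA (T x) = S (zMap hA x)) ∧ IsComplexSymmetric S

end SemiHilbert

end

open scoped InnerProductSpace

namespace SemiHilbert

open Filter Topology

section NumericalRange

variable {E : Type*} [NormedAddCommGroup E] [InnerProductSpace ℂ E]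

/-- The numerical range of a bounded operator. -/
def numericalRange (B : E →L[ℂ] E) : Set ℂ := {z | ∃ x : E, ‖x‖ = 1 ∧ z = inner ℂ x (B x)}

lemma inner_div_norm_sq_mem_numericalRange (B : E →L[ℂ] E) {x : E} (hx : x ≠ 0) :
    inner ℂ x (B x) / (‖x‖ : ℂ) ^ 2 ∈ numericalRange B := by
  have hn : (‖x‖ : ℂ) ≠ 0 := by simpa using hx
  refine ⟨(‖x‖ : ℂ)⁻¹ • x, by simp [norm_smul, hx], ?_⟩
  rw [map_smul, inner_smul_left, inner_smul_right]
  simp only [map_inv₀, Complex.conj_ofReal]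
  field_simp

/-- The core of the Toeplitz–Hausdorff theorem: a normalized form attains every value between
`0` and `1`. -/
lemma exists_inner_eq_of_zero_one (B : E →L[ℂ] E) {x y : E} (hx : ‖x‖ = 1) (hy : ‖y‖ = 1)
    (hx0 : inner ℂ x (B x) = 0) (hy1 : inner ℂ y (B y) = 1) {t : ℝ} (ht : t ∈ Set.Icc (0 : ℝ) 1) :
    ∃ z : E, ‖z‖ = 1 ∧ inner ℂ z (B z) = (t : ℂ) := by
  obtain ⟨ω, hω, hd⟩ :=
    Complex.exists_norm_eq_mul_self (inner ℂ x (B y) - (starRingEnd ℂ) (inner ℂ y (B x)))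
  have hωω : (starRingEnd ℂ) ω * ω = 1 := by
    rw [mul_comm, Complex.mul_conj, Complex.normSq_eq_norm_sq, hω]; simp
  set k : ℂ := ω * inner ℂ x (B y) + (starRingEnd ℂ) ω * inner ℂ y (B x) with hk
  have hkim : k.im = 0 := by
    have h := congrArg Complex.im hd
    simp only [Complex.ofReal_im, Complex.mul_im, Complex.sub_im, Complex.sub_re, Complex.conj_re,
      Complex.conj_im] at h
    simp only [hk, Complex.add_im, Complex.mul_im, Complex.conj_re, Complex.conj_im]
    linarith
  have hkre : k = (k.re : ℂ) := Complex.ext (by simp) (by simpa using hkim)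
  let z : ℝ → E := fun s => ((1 - s : ℝ) : ℂ) • x + ((s : ℝ) : ℂ) • ω • y
  have hval (s : ℝ) : inner ℂ (z s) (B (z s)) = ((s ^ 2 + s * (1 - s) * k.re : ℝ) : ℂ) := by
    have h2 : inner ℂ (z s) (B (z s)) = (s : ℂ) ^ 2 * ((starRingEnd ℂ) ω * ω) +
        s * (1 - s) * k := by
      simp only [z, map_add, map_smul, inner_add_left, inner_add_right, inner_smul_left,
        inner_smul_right, hx0, hy1, Complex.conj_ofReal, hk]
      push_cast
      ring
    rw [h2, hωω, hkre]
    push_cast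
    simp
  have hz0 (s : ℝ) : z s ≠ 0 := by
    intro h0
    have h1 : ((1 - s : ℝ) : ℂ) • x = -((s : ℂ) • ω • y) := eq_neg_of_add_eq_zero_left h0
    have h2 : (s : ℂ) ^ 2 * ((starRingEnd ℂ) ω * ω) = 0 := by
      have h3 : inner ℂ (((1 - s : ℝ) : ℂ) • x) (B (((1 - s : ℝ) : ℂ) • x)) = 0 := by
        rw [map_smul, inner_smul_left, inner_smul_right, hx0]; simp
      rw [h1] at h3
      simp only [map_neg, inner_neg_neg, map_smul, inner_smul_left, inner_smul_right, hy1,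
        Complex.conj_ofReal] at h3
      linear_combination h3
    rw [hωω] at h2
    have h4 : s = 0 := by simpa using h2
    subst h4
    have : x = 0 := by simpa [z] using h0
    simp [this] at hx
  have hcont : Continuous fun s : ℝ => (s ^ 2 + s * (1 - s) * k.re) / ‖z s‖ ^ 2 := by
    refine Continuous.div (by fun_prop) (by fun_prop) fun s => ?_
    exact pow_ne_zero _ (norm_ne_zero_iff.2 (hz0 s))
  have hivt := intermediate_value_Icc (zero_le_one (α := ℝ)) hcont.continuousOn
  have hz1 : ‖z 1‖ = 1 := by simp [z, norm_smul, hω, hy]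
  obtain ⟨s, -, hs⟩ := hivt (by simpa [hz1] using ht)
  obtain ⟨w, hw, hw'⟩ := inner_div_norm_sq_mem_numericalRange B (hz0 s)
  refine ⟨w, hw, ?_⟩
  rw [← hw', hval, ← hs]
  push_cast
  rfl

/-- The Toeplitz–Hausdorff theorem. -/
theorem convex_numericalRange (B : E →L[ℂ] E) : Convex ℝ (numericalRange B) := by
  rw [convex_iff_segment_subset]
  rintro p ⟨x, hx, hp⟩ q ⟨y, hy, hq⟩ w hw
  by_cases hpq : p = q
  · subst hpq
    rw [segment_same] at hw
    exact ⟨x, hx, hw.trans hp⟩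
  rw [segment_eq_image_lineMap] at hw
  obtain ⟨t, ht, rfl⟩ := hw
  have hqp : q - p ≠ 0 := sub_ne_zero.2 (Ne.symm hpq)
  let B' : E →L[ℂ] E := (q - p)⁻¹ • (B - p • ContinuousLinearMap.id ℂ E)
  have hB' (z : E) (hz : ‖z‖ = 1) : inner ℂ z (B' z) = (q - p)⁻¹ * (inner ℂ z (B z) - p) := by
    simp [B', hz]
  obtain ⟨z, hz, hzt⟩ := exists_inner_eq_of_zero_one B' hx hy (by rw [hB' x hx, ← hp]; simp)
    (by rw [hB' y hy, ← hq]; field_simp) ht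
  refine ⟨z, hz, ?_⟩
  rw [hB' z hz] at hzt
  have : inner ℂ z (B z) = p + t * (q - p) := by
    rw [← hzt]; field_simp; ring
  rw [this, AffineMap.lineMap_apply_module']
  simp only [Complex.real_smul]
  ring

end NumericalRange

section Conjugation

variable {E : Type*} [NormedAddCommGroup E] [InnerProductSpace ℂ E]

lemma inner_conj_conj (C : E →ₗᵢ⋆[ℂ] E) (x y : E) : inner ℂ (C x) (C y) = inner ℂ y x := by
  have hre (x y : E) : (inner ℂ (C x) (C y)).re = (inner ℂ x y).re := by
    have h1 := norm_add_sq (𝕜 := ℂ) (C x) (C y)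
    have h2 := norm_add_sq (𝕜 := ℂ) x y
    rw [← map_add, C.norm_map, C.norm_map, C.norm_map] at h1
    simp only [RCLike.re_to_complex] at h1 h2
    linarith
  rw [← inner_conj_symm y x]
  apply Complex.ext
  · rw [hre x y, Complex.conj_re]
  · have h := hre (Complex.I • x) y
    rw [C.map_smulₛₗ, inner_smul_left, inner_smul_left] at h
    simp at h
    simp only [Complex.conj_im]
    linarith

lemma inner_conj_right {C : E →ₗᵢ⋆[ℂ] E} {f : E} (hf : C f = f) (x : E) :
    inner ℂ f (C x) = inner ℂ x f := by
  simpa [hf] using inner_conj_conj C f x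

lemma conj_inner_of_conj_eq {C : E →ₗᵢ⋆[ℂ] E} {f a : E} (hf : C f = f) (ha : C a = a) :
    (starRingEnd ℂ) (inner ℂ f a) = inner ℂ f a := by
  rw [inner_conj_symm]
  simpa [hf, ha] using inner_conj_conj C a f

lemma inner_symm_of_conj_eq [CompleteSpace E] {C : E →ₗᵢ⋆[ℂ] E} {S : E →L[ℂ] E}
    (hS : ∀ x, S x = C (ContinuousLinearMap.adjoint S (C x))) {a b : E} (ha : C a = a)
    (hb : C b = b) : inner ℂ a (S b) = inner ℂ b (S a) := by
  rw [hS b, inner_conj_right ha, hb, ContinuousLinearMap.adjoint_inner_left]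

/-- Every vector is `a + i b` with `a`, `b` fixed by the conjugation, and then the quadratic form
of a complex symmetric operator is additive. -/
lemma inner_add_I_smul [CompleteSpace E] {C : E →ₗᵢ⋆[ℂ] E} {S : E →L[ℂ] E}
    (hS : ∀ x, S x = C (ContinuousLinearMap.adjoint S (C x))) {a b : E} (ha : C a = a)
    (hb : C b = b) : inner ℂ (a + Complex.I • b) (S (a + Complex.I • b)) =
      inner ℂ a (S a) + inner ℂ b (S b) := by
  simp only [map_add, map_smul, inner_add_left, inner_add_right, inner_smul_left,
    inner_smul_right, Complex.conj_I, inner_symm_of_conj_eq hS ha hb]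
  linear_combination (-inner ℂ b (S b)) * Complex.I_mul_I

lemma norm_sq_add_I_smul {C : E →ₗᵢ⋆[ℂ] E} {a b : E} (ha : C a = a) (hb : C b = b) :
    ‖a + Complex.I • b‖ ^ 2 = ‖a‖ ^ 2 + ‖b‖ ^ 2 := by
  have h := norm_add_sq (𝕜 := ℂ) a (Complex.I • b)
  have him : (inner ℂ a b).im = 0 := Complex.conj_eq_iff_im.1 (conj_inner_of_conj_eq ha hb)
  rw [inner_smul_right] at h
  simp [him, norm_smul] at h
  exact h

/-- The real part of a vector with respect to a conjugation. -/
noncomputable def conjRe (C : E →ₗᵢ⋆[ℂ] E) (y : E) : E := (2⁻¹ : ℂ) • (y + C y)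

/-- The imaginary part of a vector with respect to a conjugation. -/
noncomputable def conjIm (C : E →ₗᵢ⋆[ℂ] E) (y : E) : E := (-(Complex.I / 2)) • (y - C y)

lemma conj_conjRe {C : E →ₗᵢ⋆[ℂ] E} (hC : ∀ x, C (C x) = x) (y : E) :
    C (conjRe C y) = conjRe C y := by
  simp only [conjRe, C.map_smulₛₗ, map_add, hC, map_inv₀, map_ofNat, add_comm]

lemma conj_conjIm {C : E →ₗᵢ⋆[ℂ] E} (hC : ∀ x, C (C x) = x) (y : E) :
    C (conjIm C y) = conjIm C y := by
  simp only [conjIm, C.map_smulₛₗ, map_sub, hC, map_neg, map_div₀, Complex.conj_I, map_ofNat]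
  module

lemma conjRe_add_I_smul_conjIm (C : E →ₗᵢ⋆[ℂ] E) (y : E) :
    conjRe C y + Complex.I • conjIm C y = y := by
  simp only [conjRe, conjIm, smul_smul]
  have : Complex.I * -(Complex.I / 2) = 2⁻¹ := by
    linear_combination (-(1 / 2 : ℂ)) * Complex.I_mul_I
  rw [this]
  module

end Conjugation

section WeakLimits

variable {E : Type*} [NormedAddCommGroup E] [InnerProductSpace ℂ E]

/-- Bounded families in a Hilbert space converge weakly along ultrafilters. -/
lemma exists_weak_limit [CompleteSpace E] {ι : Type*} (U : Ultrafilter ι) {x : ι → E} {M : ℝ}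
    (hx : ∀ n, ‖x n‖ ≤ M) :
    ∃ x₀ : E, ∀ v, Tendsto (fun n => inner ℂ (x n) v) U (𝓝 (inner ℂ x₀ v)) := by
  let g : ι → WeakDual ℂ E := fun n => StrongDual.toWeakDual (InnerProductSpace.toDual ℂ E (x n))
  have hc := WeakDual.isCompact_closedBall (𝕜 := ℂ) (E := E) 0 M
  obtain ⟨φ, -, hφ⟩ := hc.ultrafilter_le_nhds (U.map g) (by
    rw [le_principal_iff]
    refine Filter.Eventually.of_forall (f := (U : Filter ι)) fun n => ?_
    simpa [g] using hx n)
  refine ⟨(InnerProductSpace.toDual ℂ E).symm (WeakDual.toStrongDual φ), fun v => ?_⟩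
  rw [InnerProductSpace.toDual_symm_apply]
  exact (WeakDual.eval_continuous v).continuousAt.tendsto.comp hφ

lemma tendsto_quadratic_sub {ι : Type*} {l : Filter ι} {a e : ι → E} {M : ℝ}
    (ha : ∀ n, ‖a n‖ ≤ M) (he : Tendsto e l (𝓝 0)) (S : E →L[ℂ] E) {p : ℂ}
    (hp : Tendsto (fun n => inner ℂ (a n) (S (a n))) l (𝓝 p)) :
    Tendsto (fun n => inner ℂ (a n - e n) (S (a n - e n))) l (𝓝 p) := by
  have hen : Tendsto (fun n => ‖e n‖) l (𝓝 0) := by simpa using he.norm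
  have h1 : Tendsto (fun n => inner ℂ (e n) (S (a n))) l (𝓝 0) := by
    refine squeeze_zero_norm (a := fun n => ‖e n‖ * (‖S‖ * M)) (fun n => ?_)
      (by simpa using hen.mul_const (‖S‖ * M))
    refine (norm_inner_le_norm _ _).trans ?_
    gcongr
    exact (S.le_opNorm _).trans (by gcongr; exact ha n)
  have h2 : Tendsto (fun n => inner ℂ (a n) (S (e n))) l (𝓝 0) := by
    refine squeeze_zero_norm (a := fun n => M * (‖S‖ * ‖e n‖)) (fun n => ?_)
      (by simpa using (hen.const_mul ‖S‖).const_mul M)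
    refine (norm_inner_le_norm _ _).trans ?_
    exact mul_le_mul (ha n) (S.le_opNorm _) (norm_nonneg _) ((norm_nonneg _).trans (ha n))
  have h3 : Tendsto (fun n => inner ℂ (e n) (S (e n))) l (𝓝 0) := by
    simpa using he.inner ((S.continuous.tendsto 0).comp he) (𝕜 := ℂ)
  have := ((hp.sub h1).sub h2).add h3
  simp only [sub_zero, add_zero] at this
  refine this.congr fun n => ?_
  simp only [map_sub, inner_sub_left, inner_sub_right]
  ring

end WeakLimits

section EssentialRange

variable {E : Type*} [NormedAddCommGroup E] [InnerProductSpace ℂ E]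

/-- The essential values of the quadratic form of `S` on the vectors fixed by `C`: those that are
approximately attained at fixed unit vectors orthogonal to any given finite orthonormal family of
fixed vectors. -/
def conjEssentialRange (C : E →ₗᵢ⋆[ℂ] E) (S : E →L[ℂ] E) : Set ℂ :=
  {ν | ∀ η : ℝ, 0 < η → ∀ (k : ℕ) (f : Fin k → E), Orthonormal ℂ f → (∀ j, C (f j) = f j) →
    ∃ g : E, ‖g‖ = 1 ∧ C g = g ∧ (∀ j, inner ℂ (f j) g = 0) ∧ ‖inner ℂ g (S g) - ν‖ < η}

lemma norm_inner_self_le (S : E →L[ℂ] E) (x : E) : ‖inner ℂ x (S x)‖ ≤ ‖S‖ * ‖x‖ ^ 2 := by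
  refine (norm_inner_le_norm _ _).trans ?_
  have := mul_le_mul_of_nonneg_left (S.le_opNorm x) (norm_nonneg x)
  linarith [this, sq (‖x‖)]

lemma conjEssentialRange_subset_closedBall (C : E →ₗᵢ⋆[ℂ] E) (S : E →L[ℂ] E) :
    conjEssentialRange C S ⊆ Metric.closedBall 0 (‖S‖ + 1) := by
  intro ν hν
  obtain ⟨g, hg, -, -, h⟩ := hν 1 one_pos 0 Fin.elim0 ⟨fun i => i.elim0, fun i => i.elim0⟩
    fun i => i.elim0
  have h1 := norm_inner_self_le S g
  rw [hg] at h1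
  rw [mem_closedBall_zero_iff]
  have h2 := norm_sub_norm_le ν (inner ℂ g (S g))
  rw [norm_sub_rev] at h2
  linarith

lemma div_mem_conjEssentialRange {C : E →ₗᵢ⋆[ℂ] E} {S : E →L[ℂ] E} {ι : Type*} {l : Filter ι}
    [l.NeBot] {a : ι → E} {M : ℝ} (haM : ∀ n, ‖a n‖ ≤ M) (haC : ∀ n, C (a n) = a n)
    (ha : ∀ v, Tendsto (fun n => inner ℂ v (a n)) l (𝓝 0)) {α : ℝ} (hα : α ≠ 0)
    (haα : Tendsto (fun n => ‖a n‖ ^ 2) l (𝓝 α)) {p : ℂ}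
    (hp : Tendsto (fun n => inner ℂ (a n) (S (a n))) l (𝓝 p)) :
    p / α ∈ conjEssentialRange C S := by
  intro η hη k f hf hfC
  let e : ι → E := fun n => ∑ j, (inner ℂ (f j) (a n)) • f j
  have he : Tendsto e l (𝓝 0) := by
    have := tendsto_finsetSum (Finset.univ : Finset (Fin k)) fun j _ =>
      (ha (f j)).smul_const (f j)
    simpa using this
  have hn : Tendsto (fun n => (‖a n - e n‖ : ℂ) ^ 2) l (𝓝 α) := by
    have := tendsto_quadratic_sub haM he (ContinuousLinearMap.id ℂ E) (p := (α : ℂ)) (by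
      have := (Complex.continuous_ofReal.tendsto α).comp haα
      refine this.congr fun n => ?_
      simp)
    refine this.congr fun n => ?_
    simp
  have hα' : (α : ℂ) ≠ 0 := by exact_mod_cast hα
  have hq := (tendsto_quadratic_sub haM he S hp).div hn hα'
  have hev := (Metric.tendsto_nhds.1 hq η hη).and (hn.eventually_ne hα')
  obtain ⟨n, hn1, hn2⟩ := hev.exists
  have hne : a n - e n ≠ 0 := fun h => hn2 (by simp [h])
  have hnn : (‖a n - e n‖ : ℂ) ≠ 0 := by simpa using hne
  refine ⟨(‖a n - e n‖ : ℂ)⁻¹ • (a n - e n), by simp [norm_smul, hne], ?_, fun j => ?_, ?_⟩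
  · have h1 : C (e n) = e n := by
      simp only [e, map_sum]
      refine Finset.sum_congr rfl fun j _ => ?_
      rw [C.map_smulₛₗ, hfC j, conj_inner_of_conj_eq (hfC j) (haC n)]
    rw [C.map_smulₛₗ, map_sub, h1, haC n]
    simp
  · rw [inner_smul_right, inner_sub_right]
    simp only [e, hf.inner_right_fintype, sub_self, mul_zero]
  · rw [dist_eq_norm] at hn1
    have heq : inner ℂ ((‖a n - e n‖ : ℂ)⁻¹ • (a n - e n)) (S ((‖a n - e n‖ : ℂ)⁻¹ • (a n - e n))) =
        inner ℂ (a n - e n) (S (a n - e n)) / (‖a n - e n‖ : ℂ) ^ 2 := by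
      rw [map_smul, inner_smul_left, inner_smul_right]
      simp only [map_inv₀, Complex.conj_ofReal]
      field_simp
    rw [heq]
    exact hn1

lemma exists_eq_mul_conjEssentialRange {C : E →ₗᵢ⋆[ℂ] E} {S : E →L[ℂ] E} {ι : Type*} {l : Filter ι}
    [l.NeBot] {a : ι → E} {M : ℝ} (haM : ∀ n, ‖a n‖ ≤ M) (haC : ∀ n, C (a n) = a n)
    (ha : ∀ v, Tendsto (fun n => inner ℂ v (a n)) l (𝓝 0)) {α : ℝ}
    (haα : Tendsto (fun n => ‖a n‖ ^ 2) l (𝓝 α)) {p : ℂ}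
    (hp : Tendsto (fun n => inner ℂ (a n) (S (a n))) l (𝓝 p)) :
    ∃ w : ℂ, p = α • w ∧ (α ≠ 0 → w ∈ conjEssentialRange C S) := by
  by_cases hα : α = 0
  · refine ⟨0, ?_, fun h => absurd hα h⟩
    subst hα
    have : Tendsto (fun n => inner ℂ (a n) (S (a n))) l (𝓝 0) :=
      squeeze_zero_norm (fun n => norm_inner_self_le S (a n)) (by simpa using haα.const_mul ‖S‖)
    simpa using tendsto_nhds_unique hp this
  · have hα' : (α : ℂ) ≠ 0 := by exact_mod_cast hα
    refine ⟨p / α, ?_, fun _ => div_mem_conjEssentialRange haM haC ha hα haα hp⟩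
    rw [Complex.real_smul]
    field_simp

lemma tendsto_inner_conj {C : E →ₗᵢ⋆[ℂ] E} (hC : ∀ x, C (C x) = x) {ι : Type*} {l : Filter ι}
    {y : ι → E} (hy : ∀ v, Tendsto (fun n => inner ℂ v (y n)) l (𝓝 0)) (v : E) :
    Tendsto (fun n => inner ℂ v (C (y n))) l (𝓝 0) := by
  have h := (Complex.continuous_conj.tendsto 0).comp (hy (C v))
  rw [map_zero] at h
  refine h.congr fun n => ?_
  simp only [Function.comp_apply]
  rw [inner_conj_symm, ← inner_conj_conj C (C v), hC]

/-- If the essential values of a complex symmetric operator `S` lie in the numerical range of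
`S + K`, where the quadratic form of `K` is weakly continuous at `0`, then that numerical range is
closed. -/
theorem isClosed_numericalRange_add [CompleteSpace E] {C : E →ₗᵢ⋆[ℂ] E} (hC : ∀ x, C (C x) = x)
    {S K : E →L[ℂ] E} (hS : ∀ x, S x = C (ContinuousLinearMap.adjoint S (C x)))
    (hK : ∀ (l : Filter ℕ) (y : ℕ → E), (∀ v, Tendsto (fun n => inner ℂ v (y n)) l (𝓝 0)) →
      Tendsto (fun n => inner ℂ (y n) (K (y n))) l (𝓝 0))
    (hsub : conjEssentialRange C S ⊆ numericalRange (S + K)) :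
    IsClosed (numericalRange (S + K)) := by
  refine isClosed_of_closure_subset fun lam hlam => ?_
  obtain ⟨z, hz, hzl⟩ := mem_closure_iff_seq_limit.1 hlam
  choose x hx hzx using hz
  let U : Ultrafilter ℕ := hyperfilter ℕ
  have hU : (U : Filter ℕ) ≤ atTop := Nat.hyperfilter_le_atTop
  have hzU : Tendsto z U (𝓝 lam) := hzl.mono_left hU
  obtain ⟨x₀, hx₀⟩ := exists_weak_limit U (x := x) (M := 1) fun n => (hx n).le
  have hx₀' (v : E) : Tendsto (fun n => inner ℂ v (x n)) U (𝓝 (inner ℂ v x₀)) := by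
    have h := (Complex.continuous_conj.tendsto _).comp (hx₀ v)
    rw [inner_conj_symm] at h
    exact h.congr fun n => by simp
  set B := S + K with hB
  let y : ℕ → E := fun n => x n - x₀
  have hy (v : E) : Tendsto (fun n => inner ℂ v (y n)) U (𝓝 0) := by
    have h := (hx₀' v).sub_const (inner ℂ v x₀)
    rw [sub_self] at h
    exact h.congr fun n => by simp [y]
  have hyM (n : ℕ) : ‖y n‖ ≤ 1 + ‖x₀‖ := (norm_sub_le _ _).trans (by rw [hx n])
  have hyn : Tendsto (fun n => ‖y n‖ ^ 2) U (𝓝 (1 - ‖x₀‖ ^ 2)) := by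
    have h1 : Tendsto (fun n => (inner ℂ x₀ (x n)).re) U (𝓝 (‖x₀‖ ^ 2)) := by
      have h := (Complex.continuous_re.tendsto _).comp (hx₀' x₀)
      rwa [← RCLike.re_to_complex, ← norm_sq_eq_re_inner] at h
    have h2 := (tendsto_const_nhds (x := 1 + ‖x₀‖ ^ 2)).sub (h1.const_mul 2)
    have h3 : 1 + ‖x₀‖ ^ 2 - 2 * ‖x₀‖ ^ 2 = 1 - ‖x₀‖ ^ 2 := by ring
    rw [h3] at h2
    refine h2.congr fun n => ?_
    have h4 := norm_sub_sq (𝕜 := ℂ) x₀ (x n)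
    simp only [RCLike.re_to_complex, hx n] at h4
    simp only [y]
    rw [norm_sub_rev, h4]
    ring
  have hyB : Tendsto (fun n => inner ℂ (y n) (B (y n))) U (𝓝 (lam - inner ℂ x₀ (B x₀))) := by
    have h1 := hx₀' (ContinuousLinearMap.adjoint B x₀)
    have h2 := ((hzU.sub h1).sub (hx₀ (B x₀))).add_const (inner ℂ x₀ (B x₀))
    rw [ContinuousLinearMap.adjoint_inner_left, sub_add_cancel] at h2
    refine h2.congr fun n => ?_
    simp only [y, map_sub, inner_sub_left, inner_sub_right, hzx n,
      ContinuousLinearMap.adjoint_inner_left]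
    ring
  have hyS : Tendsto (fun n => inner ℂ (y n) (S (y n))) U (𝓝 (lam - inner ℂ x₀ (B x₀))) := by
    have h := hyB.sub (hK U y hy)
    rw [sub_zero] at h
    exact h.congr fun n => by simp [hB]
  let a : ℕ → E := fun n => conjRe C (y n)
  let b : ℕ → E := fun n => conjIm C (y n)
  have haC (n : ℕ) : C (a n) = a n := conj_conjRe hC _
  have hbC (n : ℕ) : C (b n) = b n := conj_conjIm hC _
  have hab (n : ℕ) : a n + Complex.I • b n = y n := conjRe_add_I_smul_conjIm C (y n)
  have habn (n : ℕ) : ‖y n‖ ^ 2 = ‖a n‖ ^ 2 + ‖b n‖ ^ 2 := by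
    rw [← hab n, norm_sq_add_I_smul (haC n) (hbC n)]
  have habS (n : ℕ) : inner ℂ (y n) (S (y n)) = inner ℂ (a n) (S (a n)) + inner ℂ (b n) (S (b n)) := by
    rw [← hab n, inner_add_I_smul hS (haC n) (hbC n)]
  have haM (n : ℕ) : ‖a n‖ ≤ 1 + ‖x₀‖ := by
    refine le_trans ?_ (hyM n)
    refine (sq_le_sq₀ (norm_nonneg _) (norm_nonneg _)).1 ?_
    rw [habn]; linarith [sq_nonneg ‖b n‖]
  have hbM (n : ℕ) : ‖b n‖ ≤ 1 + ‖x₀‖ := by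
    refine le_trans ?_ (hyM n)
    refine (sq_le_sq₀ (norm_nonneg _) (norm_nonneg _)).1 ?_
    rw [habn]; linarith [sq_nonneg ‖a n‖]
  have haw (v : E) : Tendsto (fun n => inner ℂ v (a n)) U (𝓝 0) := by
    have h := ((hy v).add (tendsto_inner_conj hC hy v)).const_mul (2⁻¹ : ℂ)
    rw [add_zero, mul_zero] at h
    exact h.congr fun n => by simp only [a, conjRe, inner_smul_right, inner_add_right]
  have hbw (v : E) : Tendsto (fun n => inner ℂ v (b n)) U (𝓝 0) := by
    have h := ((hy v).sub (tendsto_inner_conj hC hy v)).const_mul (-(Complex.I / 2))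
    rw [sub_zero, mul_zero] at h
    exact h.congr fun n => by simp only [b, conjIm, inner_smul_right, inner_sub_right]
  obtain ⟨α, hα, haα⟩ := (isCompact_Icc (a := (0 : ℝ)) (b := (1 + ‖x₀‖) ^ 2)).ultrafilter_le_nhds
    (U.map fun n => ‖a n‖ ^ 2) (by
      rw [le_principal_iff]
      refine Filter.Eventually.of_forall (f := (U : Filter ℕ)) fun n => ⟨by positivity, ?_⟩
      exact pow_le_pow_left₀ (norm_nonneg _) (haM n) 2)
  obtain ⟨p, -, hp⟩ := (isCompact_closedBall (0 : ℂ) (‖S‖ * (1 + ‖x₀‖) ^ 2)).ultrafilter_le_nhds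
    (U.map fun n => inner ℂ (a n) (S (a n))) (by
      rw [le_principal_iff]
      refine Filter.Eventually.of_forall (f := (U : Filter ℕ)) fun n => ?_
      rw [mem_closedBall_zero_iff]
      refine (norm_inner_self_le S (a n)).trans ?_
      have := haM n
      gcongr)
  replace haα : Tendsto (fun n => ‖a n‖ ^ 2) U (𝓝 α) := haα
  replace hp : Tendsto (fun n => inner ℂ (a n) (S (a n))) U (𝓝 p) := hp
  have hbβ : Tendsto (fun n => ‖b n‖ ^ 2) U (𝓝 (1 - ‖x₀‖ ^ 2 - α)) :=
    (hyn.sub haα).congr fun n => by rw [habn]; ring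
  have hq : Tendsto (fun n => inner ℂ (b n) (S (b n))) U (𝓝 (lam - inner ℂ x₀ (B x₀) - p)) :=
    (hyS.sub hp).congr fun n => by rw [habS]; ring
  obtain ⟨w₁, hw₁, hw₁'⟩ := exists_eq_mul_conjEssentialRange haM haC haw haα hp
  obtain ⟨w₂, hw₂, hw₂'⟩ := exists_eq_mul_conjEssentialRange hbM hbC hbw hbβ hq
  have hβ : 0 ≤ 1 - ‖x₀‖ ^ 2 - α := ge_of_tendsto' hbβ fun n => by positivity
  have hmem := (convex_numericalRange B).finsum_mem
    (w := ![‖x₀‖ ^ 2, α, 1 - ‖x₀‖ ^ 2 - α])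
    (z := ![inner ℂ x₀ (B x₀) / (‖x₀‖ : ℂ) ^ 2, w₁, w₂])
    (by
      intro i
      fin_cases i
      · simp
      · simpa using hα.1
      · simpa using hβ)
    (by rw [finsum_eq_sum_of_fintype]; simp [Fin.sum_univ_three])
    (by
      intro i hi
      fin_cases i
      · exact inner_div_norm_sq_mem_numericalRange B (by simpa using hi)
      · exact hsub (hw₁' hi)
      · exact hsub (hw₂' hi))
  rw [finsum_eq_sum_of_fintype, Fin.sum_univ_three] at hmem
  convert hmem using 1
  simp only [Matrix.cons_val]
  rw [← hw₁, ← hw₂]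
  by_cases h0 : x₀ = 0
  · simp [h0]
  · have : (‖x₀‖ : ℂ) ≠ 0 := by simpa using h0
    rw [Complex.real_smul]
    push_cast
    field_simp
    ring

end EssentialRange

section DiagonalOperator

variable {E : Type*} [NormedAddCommGroup E] [InnerProductSpace ℂ E]

/-- The finite-rank operator that multiplies `f i` by `c i` and vanishes on the orthogonal
complement, for an orthonormal family `f`. -/
noncomputable def diagonalOp {m : ℕ} (c : Fin m → ℂ) (f : Fin m → E) : E →L[ℂ] E :=
  ∑ i, c i • InnerProductSpace.rankOne ℂ (f i) (f i)

lemma diagonalOp_apply {m : ℕ} (c : Fin m → ℂ) (f : Fin m → E) (x : E) :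
    diagonalOp c f x = ∑ i, (c i * inner ℂ (f i) x) • f i := by
  simp [diagonalOp, smul_smul]

lemma norm_diagonalOp_apply_le {m : ℕ} {c : Fin m → ℂ} {f : Fin m → E} (hf : Orthonormal ℂ f)
    {r : ℝ} (hr : 0 ≤ r) (hc : ∀ i, ‖c i‖ ≤ r) (x : E) : ‖diagonalOp c f x‖ ≤ r * ‖x‖ := by
  rw [← sq_le_sq₀ (norm_nonneg _) (by positivity), diagonalOp_apply]
  have h1 : ‖∑ i, (c i * inner ℂ (f i) x) • f i‖ ^ 2 = ∑ i, ‖c i * inner ℂ (f i) x‖ ^ 2 := by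
    have h := hf.inner_sum (fun i => c i * inner ℂ (f i) x) (fun i => c i * inner ℂ (f i) x)
      Finset.univ
    rw [norm_sq_eq_re_inner (𝕜 := ℂ), h]
    simp only [map_sum]
    refine Finset.sum_congr rfl fun i _ => ?_
    rw [RCLike.conj_mul]
    norm_cast
  rw [h1, mul_pow]
  have h2 : ∑ i, ‖c i * inner ℂ (f i) x‖ ^ 2 ≤ ∑ i, r ^ 2 * ‖inner ℂ (f i) x‖ ^ 2 := by
    refine Finset.sum_le_sum fun i _ => ?_
    rw [norm_mul, mul_pow]
    have := hc i
    gcongr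
  refine h2.trans ?_
  rw [← Finset.mul_sum]
  exact mul_le_mul_of_nonneg_left (hf.sum_inner_products_le x) (by positivity)

lemma inner_diagonalOp_self {m : ℕ} (c : Fin m → ℂ) {f : Fin m → E} (hf : Orthonormal ℂ f)
    (i : Fin m) : inner ℂ (f i) (diagonalOp c f (f i)) = c i := by
  rw [diagonalOp_apply, hf.inner_right_fintype, inner_self_eq_norm_sq_to_K, hf.1 i]
  simp

lemma diagonalOp_eq_conj_adjoint [CompleteSpace E] {C : E →ₗᵢ⋆[ℂ] E} {m : ℕ} (c : Fin m → ℂ)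
    {f : Fin m → E} (hfC : ∀ i, C (f i) = f i) (x : E) :
    diagonalOp c f x = C (ContinuousLinearMap.adjoint (diagonalOp c f) (C x)) := by
  have hadj : ContinuousLinearMap.adjoint (diagonalOp c f) =
      diagonalOp (fun i => (starRingEnd ℂ) (c i)) f := by
    simp only [diagonalOp, map_sum, map_smulₛₗ, InnerProductSpace.adjoint_rankOne]
  rw [hadj, diagonalOp_apply, diagonalOp_apply, map_sum]
  refine Finset.sum_congr rfl fun i _ => ?_
  rw [C.map_smulₛₗ, hfC i, map_mul, Complex.conj_conj, inner_conj_right (hfC i), inner_conj_symm]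

lemma tendsto_inner_diagonalOp {m : ℕ} (c : Fin m → ℂ) (f : Fin m → E) {ι : Type*} {l : Filter ι}
    {y : ι → E} (hy : ∀ v, Tendsto (fun n => inner ℂ v (y n)) l (𝓝 0)) :
    Tendsto (fun n => inner ℂ (y n) (diagonalOp c f (y n))) l (𝓝 0) := by
  have hterm (i : Fin m) : Tendsto (fun n => c i * inner ℂ (f i) (y n) *
      (starRingEnd ℂ) (inner ℂ (f i) (y n))) l (𝓝 0) := by
    have h := ((hy (f i)).const_mul (c i)).mul ((Complex.continuous_conj.tendsto _).comp (hy (f i)))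
    simpa using h
  have h := tendsto_finsetSum Finset.univ fun i _ => hterm i
  simp only [Finset.sum_const_zero] at h
  refine h.congr fun n => ?_
  rw [diagonalOp_apply, inner_sum]
  refine Finset.sum_congr rfl fun i _ => ?_
  rw [inner_smul_right, inner_conj_symm]

lemma isCompactOperator_diagonalOp {m : ℕ} (c : Fin m → ℂ) (f : Fin m → E) :
    IsCompactOperator (diagonalOp c f) := by
  refine Submodule.sum_mem (compactOperator (RingHom.id ℂ) E E) fun i _ =>
    Submodule.smul_mem _ (c i) ?_
  exact (isCompactOperator_of_locallyCompactSpace_rng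
    (ContinuousLinearMap.toSpanSingleton ℂ (f i))).comp_clm (innerSL ℂ (f i))

end DiagonalOperator

section Perturbation

variable {E : Type*} [NormedAddCommGroup E] [InnerProductSpace ℂ E]

lemma exists_orthonormal_of_mem_conjEssentialRange {C : E →ₗᵢ⋆[ℂ] E} {S : E →L[ℂ] E} {η : ℝ}
    (hη : 0 < η) {m : ℕ} (μ : Fin m → ℂ) (hμ : ∀ i, μ i ∈ conjEssentialRange C S) :
    ∃ f : Fin m → E, Orthonormal ℂ f ∧ (∀ i, C (f i) = f i) ∧
      ∀ i, ‖inner ℂ (f i) (S (f i)) - μ i‖ < η := by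
  induction m with
  | zero => exact ⟨Fin.elim0, ⟨fun i => i.elim0, fun i => i.elim0⟩, fun i => i.elim0,
      fun i => i.elim0⟩
  | succ m ih =>
    obtain ⟨f, hf, hfC, hfμ⟩ := ih (fun i => μ i.succ) fun i => hμ i.succ
    obtain ⟨g, hg, hgC, hgf, hgμ⟩ := hμ 0 η hη m f hf hfC
    refine ⟨Fin.cons g f, ⟨fun i => ?_, fun i j hij => ?_⟩, fun i => ?_, fun i => ?_⟩
    · cases i using Fin.cases with
      | zero => simpa using hg
      | succ i => simpa using hf.1 i
    · cases i using Fin.cases with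
      | zero =>
        cases j using Fin.cases with
        | zero => exact absurd rfl hij
        | succ j => simpa using inner_eq_zero_symm.1 (hgf j)
      | succ i =>
        cases j using Fin.cases with
        | zero => simpa using hgf i
        | succ j => simpa using hf.2 fun h => hij (congrArg Fin.succ h)
    · cases i using Fin.cases with
      | zero => simpa using hgC
      | succ i => simpa using hfC i
    · cases i using Fin.cases with
      | zero => simpa using hgμ
      | succ i => simpa using hfμ i

/-- A disc of radius `δ` lies in the convex hull of four points at distance `2 δ` from its
center. -/
lemma mem_of_convex_of_corners {s : Set ℂ} (hs : Convex ℝ s) {δ : ℝ} (hδ : 0 < δ) {μ ν : ℂ}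
    (hν : ‖ν - μ‖ < δ) (h : ∀ k : Fin 4, μ + 2 * δ * Complex.I ^ (k : ℕ) ∈ s) : ν ∈ s := by
  set u := ν - μ with hu
  have hre := abs_le.1 ((Complex.abs_re_le_norm u).trans hν.le)
  have him := abs_le.1 ((Complex.abs_im_le_norm u).trans hν.le)
  have hre1 : -1 ≤ u.re / δ := by rw [le_div_iff₀ hδ]; linarith
  have hre2 : u.re / δ ≤ 1 := by rw [div_le_iff₀ hδ]; linarith
  have him1 : -1 ≤ u.im / δ := by rw [le_div_iff₀ hδ]; linarith
  have him2 : u.im / δ ≤ 1 := by rw [div_le_iff₀ hδ]; linarith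
  have hmem := hs.sum_mem (t := Finset.univ)
    (w := ![(1 + u.re / δ) / 4, (1 + u.im / δ) / 4, (1 - u.re / δ) / 4, (1 - u.im / δ) / 4])
    (z := fun k : Fin 4 => μ + 2 * δ * Complex.I ^ (k : ℕ))
    (by
      intro i _
      fin_cases i <;> simp <;> linarith)
    (by simp [Fin.sum_univ_four]; ring)
    (fun i _ => h i)
  have hν' : ν = μ + (u.re + u.im * Complex.I) := by rw [Complex.re_add_im, hu]; ring
  have hδ' : (δ : ℂ) ≠ 0 := by exact_mod_cast hδ.ne'
  convert hmem using 1
  rw [Fin.sum_univ_four, hν']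
  simp only [Complex.real_smul, Matrix.cons_val, Fin.val_zero, Fin.val_one, Fin.val_two,
    show ((3 : Fin 4) : ℕ) = 3 from rfl, pow_zero, pow_one, Complex.I_sq, Complex.I_pow_three]
  push_cast
  field_simp
  ring

/-- A small finite-rank diagonal perturbation moves the essential values of a complex symmetric
operator into its numerical range. -/
theorem exists_diagonalOp_conjEssentialRange_subset (C : E →ₗᵢ⋆[ℂ] E) (S : E →L[ℂ] E) {r : ℝ}
    (hr : 0 < r) : ∃ (m : ℕ) (c : Fin m → ℂ) (f : Fin m → E), Orthonormal ℂ f ∧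
      (∀ i, C (f i) = f i) ∧ (∀ i, ‖c i‖ ≤ r) ∧
      conjEssentialRange C S ⊆ numericalRange (S + diagonalOp c f) := by
  have htb : TotallyBounded (conjEssentialRange C S) :=
    (isCompact_closedBall (0 : ℂ) (‖S‖ + 1)).totallyBounded.subset
      (conjEssentialRange_subset_closedBall C S)
  set δ := r / 3 with hδ
  have hδ0 : 0 < δ := by positivity
  obtain ⟨t, hts, htf, htc⟩ := Metric.finite_approx_of_totallyBounded htb δ hδ0
  have := htf.to_subtype
  obtain ⟨m, ⟨e⟩⟩ := Finite.exists_equiv_fin (t × Fin 4)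
  let μ : Fin m → ℂ := fun i => ((e.symm i).1 : ℂ)
  obtain ⟨f, hf, hfC, hfμ⟩ := exists_orthonormal_of_mem_conjEssentialRange hδ0 μ
    fun i => hts (e.symm i).1.2
  let c : Fin m → ℂ := fun i =>
    μ i + 2 * δ * Complex.I ^ ((e.symm i).2 : ℕ) - inner ℂ (f i) (S (f i))
  refine ⟨m, c, f, hf, hfC, fun i => ?_, fun ν hν => ?_⟩
  · have h1 : c i = 2 * δ * Complex.I ^ ((e.symm i).2 : ℕ) - (inner ℂ (f i) (S (f i)) - μ i) := by
      simp only [c]; ring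
    have h2 : ‖(2 * δ * Complex.I ^ ((e.symm i).2 : ℕ) : ℂ)‖ = 2 * δ := by
      simp [abs_of_pos hδ0]
    rw [h1]
    refine (norm_sub_le _ _).trans ?_
    rw [h2]
    linarith [hfμ i]
  · obtain ⟨x, hx, hνx⟩ := Set.mem_iUnion₂.1 (htc hν)
    refine mem_of_convex_of_corners (convex_numericalRange _) hδ0 (μ := x)
      (by rwa [Metric.mem_ball, dist_eq_norm] at hνx) fun k => ?_
    refine ⟨f (e (⟨x, hx⟩, k)), hf.1 _, ?_⟩
    rw [_root_.add_apply, inner_add_right, inner_diagonalOp_self c hf]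
    simp [c, μ]

/-- A complex symmetric operator has arbitrarily small finite-rank perturbations that are complex
symmetric and have closed numerical range. -/
theorem exists_diagonalOp_isClosed_numericalRange [CompleteSpace E] {S : E →L[ℂ] E}
    (hS : IsComplexSymmetric S) {r : ℝ} (hr : 0 < r) :
    ∃ (m : ℕ) (c : Fin m → ℂ) (f : Fin m → E), (∀ x, ‖diagonalOp c f x‖ ≤ r * ‖x‖) ∧
      IsComplexSymmetric (S + diagonalOp c f) ∧ IsClosed (numericalRange (S + diagonalOp c f)) := by
  obtain ⟨C, hC, hSC⟩ := hS
  obtain ⟨m, c, f, hf, hfC, hc, hsub⟩ := exists_diagonalOp_conjEssentialRange_subset C S hr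
  refine ⟨m, c, f, norm_diagonalOp_apply_le hf hr.le hc, ⟨C, hC, fun x => ?_⟩,
    isClosed_numericalRange_add hC hSC (fun l y hy => tendsto_inner_diagonalOp c f hy) hsub⟩
  rw [map_add, _root_.add_apply, _root_.add_apply, map_add, ← hSC,
    ← diagonalOp_eq_conj_adjoint c hfC]

end Perturbation

section Transfer

variable {H : Type*} [NormedAddCommGroup H] [InnerProductSpace ℂ H] [CompleteSpace H]
  {A : H →L[ℂ] H}

lemma zMap_eq_mk (hA : A.IsPositive) (x : H) : zMap hA x = RSqrt.mk A (CFC.sqrt A x) :=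
  Subtype.ext (RSqrt.sqrt_sqrt_apply hA x).symm

lemma inner_sqrt_left (A : H →L[ℂ] H) (x y : H) :
    inner ℂ (CFC.sqrt A x) y = inner ℂ x (CFC.sqrt A y) := by
  have hS : IsSelfAdjoint (CFC.sqrt A : H →L[ℂ] H) := (CFC.sqrt_nonneg A).isSelfAdjoint
  have h := ContinuousLinearMap.adjoint_inner_left (CFC.sqrt A : H →L[ℂ] H) y x
  rwa [hS.adjoint_eq] at h

lemma sqrt_apply_mem_orthogonal_ker (A : H →L[ℂ] H) (x : H) :
    CFC.sqrt A x ∈ (LinearMap.ker (CFC.sqrt A : H →L[ℂ] H).toLinearMap)ᗮ := by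
  rw [Submodule.mem_orthogonal]
  intro u hu
  have hu' : CFC.sqrt A u = 0 := hu
  rw [← inner_sqrt_left, hu', inner_zero_left]

lemma lift_zMap (hA : A.IsPositive) (x : H) : RSqrt.lift A (zMap hA x) = CFC.sqrt A x := by
  rw [zMap_eq_mk, RSqrt.lift_mk,
    Submodule.starProjection_eq_self_iff.mpr (sqrt_apply_mem_orthogonal_ker A x)]

lemma inner_zMap_zMap (hA : A.IsPositive) (x y : H) :
    inner ℂ (zMap hA x) (zMap hA y) = aInner A y x := by
  change inner ℂ (RSqrt.lift A (zMap hA x)) (RSqrt.lift A (zMap hA y)) = inner ℂ x (A y)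
  rw [lift_zMap, lift_zMap, inner_sqrt_left, RSqrt.sqrt_sqrt_apply hA]

lemma norm_zMap (hA : A.IsPositive) (x : H) : ‖zMap hA x‖ = aSeminorm A x := by
  rw [aSeminorm, ← inner_zMap_zMap hA, ← RCLike.re_to_complex, ← norm_sq_eq_re_inner,
    Real.sqrt_sq (norm_nonneg _)]

/-- `Z_A` as a bounded operator. -/
noncomputable def zMapL (hA : A.IsPositive) : H →L[ℂ] RSqrt A :=
  (zMap hA).mkContinuous ‖(CFC.sqrt A : H →L[ℂ] H)‖ fun x => by
    change ‖RSqrt.lift A (zMap hA x)‖ ≤ _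
    rw [lift_zMap]
    exact ContinuousLinearMap.le_opNorm _ _

lemma zMapL_apply (hA : A.IsPositive) (x : H) : zMapL hA x = zMap hA x := rfl

lemma zMap_surjective (hA : A.IsPositive) (hclosed : IsClosed (Set.range A)) :
    Function.Surjective (zMap hA) := by
  intro u
  obtain ⟨x, rfl⟩ := RSqrt.mk_surjective A u
  have h := sqrt_apply_mem_orthogonal_ker A x
  rw [RSqrt.ker_sqrt_orthogonal hA, ← SetLike.mem_coe, Submodule.topologicalClosure_coe] at h
  have hcl : closure ((LinearMap.range A.toLinearMap : Submodule ℂ H) : Set H) = Set.range A :=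
    hclosed.closure_eq
  rw [hcl] at h
  obtain ⟨y, hy⟩ := h
  exact ⟨y, Subtype.ext hy⟩

/-- When `R(A)` is closed, every finite-rank diagonal operator on `R(A^{1/2})` is induced by an
operator on `H`. -/
lemma exists_zMap_eq_diagonalOp (hA : A.IsPositive) (hclosed : IsClosed (Set.range A)) {m : ℕ}
    (c : Fin m → ℂ) (f : Fin m → RSqrt A) :
    ∃ K : H →L[ℂ] H, ∀ x, zMap hA (K x) = diagonalOp c f (zMap hA x) := by
  choose g hg using fun i => zMap_surjective hA hclosed (f i)
  refine ⟨∑ i, c i • ((innerSL ℂ (f i)).comp (zMapL hA)).smulRight (g i), fun x => ?_⟩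
  rw [diagonalOp_apply, _root_.sum_apply, map_sum]
  refine Finset.sum_congr rfl fun i _ => ?_
  simp [hg, zMapL_apply, smul_smul]

lemma isABounded_of_zMap_eq (hA : A.IsPositive) {K : H →L[ℂ] H} {G : RSqrt A →L[ℂ] RSqrt A}
    (hK : ∀ x, zMap hA (K x) = G (zMap hA x)) : IsABounded A K := by
  refine ⟨‖G‖ + 1, by positivity, fun x => ?_⟩
  rw [← norm_zMap hA, ← norm_zMap hA, hK]
  refine (G.le_opNorm _).trans ?_
  gcongr
  linarith

lemma isACompact_of_zMap_eq (hA : A.IsPositive) (hclosed : IsClosed (Set.range A)) {K : H →L[ℂ] H}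
    {G : RSqrt A →L[ℂ] RSqrt A} (hK : ∀ x, zMap hA (K x) = G (zMap hA x))
    (hG : IsCompactOperator G) : IsACompact A K := by
  refine ⟨isABounded_of_zMap_eq hA hK, fun x ⟨M, hM⟩ => ?_⟩
  obtain ⟨Q, hQ, hGQ⟩ := IsCompactOperator.image_closedBall_subset_compact (f := G.toLinearMap) hG M
  obtain ⟨y, -, φ, hφ, hlim⟩ := hQ.tendsto_subseq (x := fun n => G (zMap hA (x n))) fun n =>
    hGQ ⟨zMap hA (x n), by simpa [norm_zMap] using hM n, rfl⟩
  obtain ⟨w, rfl⟩ := zMap_surjective hA hclosed y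
  refine ⟨φ, w, hφ, ?_⟩
  refine (tendsto_iff_norm_sub_tendsto_zero.1 hlim).congr fun n => ?_
  rw [← norm_zMap hA, map_sub, hK]
  rfl

lemma aOpNorm_le_of_zMap_eq (hA : A.IsPositive) {K : H →L[ℂ] H} {G : RSqrt A →L[ℂ] RSqrt A}
    (hK : ∀ x, zMap hA (K x) = G (zMap hA x)) {r : ℝ} (hr : 0 ≤ r)
    (hG : ∀ u, ‖G u‖ ≤ r * ‖u‖) : aOpNorm A K ≤ r := by
  refine Real.sSup_le ?_ hr
  rintro _ ⟨x, -, -, rfl⟩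
  rw [← norm_zMap hA, ← norm_zMap hA, hK]
  exact div_le_of_le_mul₀ (norm_nonneg _) hr (hG _)

lemma aNumericalRange_eq_of_zMap_eq (hA : A.IsPositive) (hclosed : IsClosed (Set.range A))
    {T : H →L[ℂ] H} {S : RSqrt A →L[ℂ] RSqrt A} (hT : ∀ x, zMap hA (T x) = S (zMap hA x)) :
    aNumericalRange A T = numericalRange S := by
  ext z
  constructor
  · rintro ⟨x, hx, rfl⟩
    exact ⟨zMap hA x, by rw [norm_zMap, hx], by rw [← hT, inner_zMap_zMap]⟩
  · rintro ⟨u, hu, rfl⟩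
    obtain ⟨x, rfl⟩ := zMap_surjective hA hclosed u
    exact ⟨x, by rw [← norm_zMap hA, hu], by rw [← hT, inner_zMap_zMap]⟩

end Transfer

end SemiHilbert

theorem mainTheorem4 {H : Type*} [NormedAddCommGroup H] [InnerProductSpace ℂ H] [CompleteSpace H]
    [TopologicalSpace.SeparableSpace H] (hdim : ¬ FiniteDimensional ℂ H)
    (A : H →L[ℂ] H) (hA : A.IsPositive) (hA0 : A ≠ 0) (hclosed : IsClosed (Set.range A))
    (T : H →L[ℂ] H) (hT : SemiHilbert.IsABounded A T) (hCSO : SemiHilbert.InducesCSO hA T)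
    (ε : ℝ) (hε : 0 < ε) :
    ∃ K : H →L[ℂ] H, SemiHilbert.IsACompact A K ∧ SemiHilbert.aOpNorm A K < ε ∧
      SemiHilbert.InducesCSO hA (T + K) ∧
      closure (SemiHilbert.aNumericalRange A (T + K)) =
        SemiHilbert.aNumericalRange A (T + K) := by
  obtain ⟨-, S, hS, hSC⟩ := hCSO
  obtain ⟨m, c, f, hnorm, hsymm, hclosedW⟩ :=
    SemiHilbert.exists_diagonalOp_isClosed_numericalRange hSC (half_pos hε)
  obtain ⟨K, hK⟩ := SemiHilbert.exists_zMap_eq_diagonalOp hA hclosed c f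
  have hTK (x : H) : SemiHilbert.zMap hA ((T + K) x) =
      (S + SemiHilbert.diagonalOp c f) (SemiHilbert.zMap hA x) := by
    rw [add_apply, add_apply, map_add, hS, hK]
  refine ⟨K, SemiHilbert.isACompact_of_zMap_eq hA hclosed hK
      (SemiHilbert.isCompactOperator_diagonalOp c f),
    (SemiHilbert.aOpNorm_le_of_zMap_eq hA hK (half_pos hε).le hnorm).trans_lt (half_lt_self hε),
    ⟨SemiHilbert.isABounded_of_zMap_eq hA hTK, _, hTK, hsymm⟩, ?_⟩
  rw [SemiHilbert.aNumericalRange_eq_of_zMap_eq hA hclosed hTK]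
  exact hclosedW.closure_eq
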